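/- Let $d\ge 1$ and let $X=(X_t)_{t\ge 0}$ be a Lévy process in $\mathbb R^d$, started at an arbitrary point, with characteristic exponent $$\Phi(\xi)=\frac{|\xi|^2}{\ln(1+|\xi|^2)}-1\quad(\xi\neq 0),\qquad \Phi(0)=0,$$ that is, $\mathbb E\,e^{i\xi\cdot(X_t-X_0)}=e^{-t\Phi(\xi)}$ for all $t\ge0$ and $\xi\in\mathbb R^d$. Put $\phi(\lambda)=\frac{\lambda}{\ln(1+\lambda)}-1$ for $\lambda>0$. There is a Lévy measure of a subordinator with Laplace exponent $\phi$, that is, a measure $\mu$ on $(0,\infty)$ with $\int_{(0,\infty)}(1\wedge t)\,\mu(dt)<\infty$ such that, for some $b\ge 0$, $\phi(\lambda)=b\lambda+\int_{(0,\infty)}(1-e^{-\lambda t})\,\mu(dt)$ for all $\lambda>0$. For every such $\mu$, define $$j(r)=(4\pi)^{-d/2}\int_{(0,\infty)}t^{-d/2}e^{-r^2/(4t)}\,\mu(dt),\qquad r>0 .$$ Then the following hold. 1. $X$ has no Gaussian part and has Lévy density $J(y)=j(|y|)$: $\int_{\mathbb R^d\setminus\{0\}}(1\wedge|y|^2)\,j(|y|)\,dy<\infty$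 and $$\Phi(\xi)=-\int_{\mathbb R^d\setminus\{0\}}\left(e^{i\xi\cdot y}-1-i\,\xi\cdot y\,1_{\{|y|<1\}}\right)j(|y|)\,dy,\qquad \xi\in\mathbb R^d .$$ 2. $$j(r)\sim\frac{4\,\Gamma(\frac d2+1)}{\pi^{d/2}}\cdot\frac{1}{r^{d+2}\left(\ln\frac1{r^2}\right)^2}\qquad\text{as } r\to0+ .$$ 3. The small jumps of $X$ are more intense than those of any rotationally invariant stable process: for every $\alpha\in(0,2)$, $j(r)/j^{(\alpha)}(r)\to\infty$ as $r\to0+$, where $$j^{(\alpha)}(r)=\frac{\alpha 2^{\alpha-1}\Gamma(\frac d2+\frac\alpha2)}{\pi^{d/2}\,\Gamma(1-\frac\alpha2)}\cdot\frac1{r^{d+\alpha}}$$ is the radial profile of the Lévy density of the rotationally invariant $\alpha$-stable process in $\mathbb R^d$ with characteristic exponent $|\xi|^\alpha$. -/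

import Mathlib

open MeasureTheory ProbabilityTheory Filter Asymptotics
open scoped NNReal ENNReal Topology

noncomputable section

namespace ConjGamma

/-- A Lévy process in `ℝ^d` under the law `P`, started at `x`: it starts at `x` almost surely, has
independent and stationary increments, and almost all of its paths are right-continuous with left
limits. -/
structure IsLevyProcess {d : ℕ} {Ω : Type*} [MeasurableSpace Ω] (P : Measure Ω)
    (x : EuclideanSpace ℝ (Fin d)) (X : ℝ≥0 → Ω → EuclideanSpace ℝ (Fin d)) : Prop where
  measurable : ∀ t, Measurable (X t)
  start : ∀ᵐ ω ∂P, X 0 ω = x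
  indep : HasIndepIncrements X P
  stationary : ∀ s t, IdentDistrib (fun ω => X (s + t) ω - X s ω) (fun ω => X t ω - X 0 ω) P P
  cadlag : ∀ᵐ ω ∂P, ∀ t, ContinuousWithinAt (fun s => X s ω) (Set.Ici t) t ∧
    ∃ l, Tendsto (fun s => X s ω) (𝓝[<] t) (𝓝 l)

/-- `X` has characteristic exponent `Φ`: `E exp(i ξ · (X_t - X_0)) = exp(-t Φ(ξ))`. -/
def HasCharExponent {d : ℕ} {Ω : Type*} [MeasurableSpace Ω] (P : Measure Ω)
    (X : ℝ≥0 → Ω → EuclideanSpace ℝ (Fin d)) (Φ : EuclideanSpace ℝ (Fin d) → ℂ) : Prop :=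
  ∀ (t : ℝ≥0) (ξ : EuclideanSpace ℝ (Fin d)),
    charFun (P.map (fun ω => X t ω - X 0 ω)) ξ = Complex.exp (-((t : ℝ) : ℂ) * Φ ξ)

/-- A Lévy measure on `ℝ^d`: no mass at the origin, and `∫ (1 ∧ |y|²) Π(dy) < ∞`. -/
def IsLevyMeasure {d : ℕ} (Lm : Measure (EuclideanSpace ℝ (Fin d))) : Prop :=
  Lm {0} = 0 ∧ ∫⁻ y, ENNReal.ofReal (min 1 (‖y‖ ^ 2)) ∂Lm < ∞

/-- The exponent that the Lévy–Khintchine formula attaches to the drift `γ`, the Gaussian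
covariance `A` and the Lévy measure `Lm`, in the sign convention `E exp(i ξ · X_t) = exp(-t Φ(ξ))`. -/
def levyKhintchine {d : ℕ} (γ : EuclideanSpace ℝ (Fin d))
    (A : EuclideanSpace ℝ (Fin d) →L[ℝ] EuclideanSpace ℝ (Fin d))
    (Lm : Measure (EuclideanSpace ℝ (Fin d))) (ξ : EuclideanSpace ℝ (Fin d)) : ℂ :=
  -(Complex.I * (inner ℝ γ ξ : ℝ)) + ((inner ℝ (A ξ) ξ / 2 : ℝ) : ℂ)
    - ∫ y, (Complex.exp (Complex.I * (inner ℝ y ξ : ℝ)) - 1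
        - Complex.I * (({y | ‖y‖ < 1} : Set (EuclideanSpace ℝ (Fin d))).indicator
            (fun y => inner ℝ y ξ) y : ℝ)) ∂Lm

/-- `(γ, A, Lm)` is the characteristic triplet of the process `X`; in particular `Lm` is the
Lévy measure of `X`. -/
def HasLevyTriplet {d : ℕ} {Ω : Type*} [MeasurableSpace Ω] (P : Measure Ω)
    (X : ℝ≥0 → Ω → EuclideanSpace ℝ (Fin d)) (γ : EuclideanSpace ℝ (Fin d))
    (A : EuclideanSpace ℝ (Fin d) →L[ℝ] EuclideanSpace ℝ (Fin d))
    (Lm : Measure (EuclideanSpace ℝ (Fin d))) : Prop :=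
  A.IsPositive ∧ IsLevyMeasure Lm ∧ HasCharExponent P X (levyKhintchine γ A Lm)

/-- `μ` is the Lévy measure of a subordinator with Laplace exponent `f`: a measure carried by
`(0, ∞)` with `∫ (1 ∧ t) μ(dt) < ∞` such that, for some drift `b ≥ 0`,
`f(l) = b l + ∫_{(0,∞)} (1 - exp(-l t)) μ(dt)` for all `l > 0`. -/
def IsSubordinatorLevyMeasure (f : ℝ → ℝ) (μ : Measure ℝ) : Prop :=
  μ (Set.Iic 0) = 0 ∧ ∫⁻ t, ENNReal.ofReal (min 1 t) ∂μ < ∞ ∧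
    ∃ b : ℝ, 0 ≤ b ∧ ∀ l : ℝ, 0 < l → f l = b * l + ∫ t in Set.Ioi 0, (1 - Real.exp (-l * t)) ∂μ

/-- The Laplace exponent `φ(l) = l / ln(1 + l) - 1`, extended by continuity by `φ(0) = 0`. -/
def phi (l : ℝ) : ℝ := if l = 0 then 0 else l / Real.log (1 + l) - 1

/-- The characteristic exponent `Φ(ξ) = φ(|ξ|²)` on `ℝ^d`. -/
def Phi {d : ℕ} (ξ : EuclideanSpace ℝ (Fin d)) : ℂ := (phi (‖ξ‖ ^ 2) : ℝ)

/-- `j(r) = (4π)^{-d/2} ∫_{(0,∞)} t^{-d/2} exp(-r²/(4t)) μ(dt)`. -/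
def radialLevyDensity (d : ℕ) (μ : Measure ℝ) (r : ℝ) : ℝ :=
  (4 * Real.pi) ^ (-(d : ℝ) / 2) *
    ∫ t in Set.Ioi 0, t ^ (-(d : ℝ) / 2) * Real.exp (-r ^ 2 / (4 * t)) ∂μ

/-- The radial profile of the Lévy density of the rotationally invariant `α`-stable process in
`ℝ^d` with characteristic exponent `|ξ|^α`, `0 < α < 2`. -/
def stableLevyDensity (d : ℕ) (α r : ℝ) : ℝ :=
  α * 2 ^ (α - 1) * Real.Gamma ((d : ℝ) / 2 + α / 2)
      / (Real.pi ^ ((d : ℝ) / 2) * Real.Gamma (1 - α / 2))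
    * (1 / r ^ ((d : ℝ) + α))

end ConjGamma

end

/-!
The starting point is the identity `l / log (1 + l) = ∫₀¹ (1 + l)^{1 - u} du`. It shows that `phi` is
an average of the Laplace exponents `(1 + l)^{1 - u} - 1`, whose Lévy densities
`(1 - u) / Γ(u) t^{u - 2} e^{-t}` are explicit. Averaging these over `u ∈ (0, 1)` gives an explicit
Lévy measure `subordinatorMeasure` for `phi`
(`isSubordinatorLevyMeasure_subordinatorMeasure`). It is the only one
(`IsSubordinatorLevyMeasure.unique`): if `μ` has drift `b`, the difference `f (l + 2) - f (l + 1)` is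
the Laplace transform of the finite measure `e^{-t} (1 - e^{-t}) μ(dt) + b δ₀`, which converges for
`l > -1`, so that the identity theorem determines its characteristic function. All the claims
therefore only concern `subordinatorMeasure`.

The Lévy triplet comes from subordination. The density `j(|y|)` is the mixture of the heat kernels
over `subordinatorMeasure`; it is symmetric, so only `1 - cos (y · ξ)` contributes to the
Lévy–Khintchine integral. As this is nonnegative, Tonelli's theorem and the Gaussian characteristic
function reduce the integral to `∫ (1 - e^{-t |ξ|²}) μ(dt) = phi (|ξ|²)`
(`integral_levyIntegrand`).

For the behaviour at the origin put `L = log (1 / r²)` and substitute `t = r² τ` and `u = w / L`. This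
writes `r^{d + 2} L² j(r)` exactly as a constant times
`∫ τ^{-d/2 - 2} e^{-1/(4τ)} e^{-r² τ} A(L, τ) dτ`, where
`A(L, τ) = ∫₀^L w e^{-w} τ^{w/L} (1 - w/L) / Γ(1 + w/L) dw` tends to `∫ w e^{-w} dw = 1` and is at most
`C (1 + τ)`. Dominated convergence, which needs `d ≥ 1` for integrability at `τ = ∞`, gives the limit
`4^{d/2 + 1} Γ(d/2 + 1)` (`tendsto_rescaledDensity`). The comparison with stable densities is then
the fact that `exp ((1 - α / 2) L)` dominates `L²`.
-/

namespace ConjGamma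

open Set

/-! ### Uniqueness of the Lévy measure of a subordinator -/

/-- Two finite measures on `ℝ` whose moment generating functions are finite and agree on a half-line
containing the origin are equal: their complex extensions agree near the origin, hence on the
half-plane that contains the imaginary axis. -/
theorem ext_of_mgf_eqOn_Iio {ν ν' : Measure ℝ} [IsFiniteMeasure ν] [IsFiniteMeasure ν'] {r : ℝ}
    (hr : 0 < r) (hν : Iio r ⊆ integrableExpSet id ν) (hν' : Iio r ⊆ integrableExpSet id ν')
    (h : EqOn (mgf id ν) (mgf id ν') (Iio r)) : ν = ν' := by
  have hX : AnalyticOnNhd ℂ (complexMGF id ν) {z | z.re ∈ Iio r} :=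
    analyticOnNhd_complexMGF.mono fun z hz => interior_maximal hν isOpen_Iio hz
  have hY : AnalyticOnNhd ℂ (complexMGF id ν') {z | z.re ∈ Iio r} :=
    analyticOnNhd_complexMGF.mono fun z hz => interior_maximal hν' isOpen_Iio hz
  have key : EqOn (complexMGF id ν) (complexMGF id ν') {z | z.re ∈ Iio r} := by
    refine AnalyticOnNhd.eqOn_of_preconnected_of_frequently_eq hX hY
      ((convex_Iio r).linear_preimage Complex.reLm).isPreconnected
      (z₀ := ((0 : ℝ) : ℂ)) (by simpa using hr) ?_
    have h_real : ∃ᶠ (x : ℝ) in 𝓝[≠] 0, complexMGF id ν x = complexMGF id ν' x := by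
      refine Eventually.frequently ?_
      filter_upwards [nhdsWithin_le_nhds (Iio_mem_nhds hr)] with x hx
      rw [complexMGF_ofReal, complexMGF_ofReal, h hx]
    rw [frequently_iff_seq_forall] at h_real ⊢
    obtain ⟨xs, hx_tendsto, hx_eq⟩ := h_real
    refine ⟨fun n => xs n, ?_, fun n => hx_eq n⟩
    rw [tendsto_nhdsWithin_iff] at hx_tendsto ⊢
    refine ⟨(Complex.continuous_ofReal.tendsto 0).comp hx_tendsto.1, ?_⟩
    simpa using hx_tendsto.2
  refine Measure.ext_of_charFun ?_
  ext t
  rw [← complexMGF_id_mul_I, ← complexMGF_id_mul_I]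
  exact key (by simpa using hr)

theorem min_one_le_two_mul_one_sub_exp_neg {t : ℝ} (ht : 0 ≤ t) :
    min 1 t ≤ 2 * (1 - Real.exp (-t)) := by
  have h1 : Real.exp (-t) ≤ 1 / (1 + t) := by
    rw [Real.exp_neg, ← one_div]
    exact one_div_le_one_div_of_le (by linarith) (by linarith [Real.add_one_le_exp t])
  have h2 : 1 - 1 / (1 + t) = t / (1 + t) := by field_simp; ring
  have h3 : min 1 t ≤ 2 * (t / (1 + t)) := by
    rw [← mul_div_assoc, le_div_iff₀ (by linarith)]
    rcases le_total t 1 with h | h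
    · rw [min_eq_right h]; nlinarith
    · rw [min_eq_left h]; linarith
  linarith

theorem abs_one_sub_exp_neg_mul_le {l t : ℝ} (hl : 0 ≤ l) (ht : 0 ≤ t) :
    |1 - Real.exp (-l * t)| ≤ (1 + l) * min 1 t := by
  have h0 : Real.exp (-l * t) ≤ 1 := Real.exp_le_one_iff.2 (by nlinarith [mul_nonneg hl ht])
  rw [abs_of_nonneg (by linarith)]
  have h1 := Real.add_one_le_exp (-l * t)
  have h2 := Real.exp_pos (-l * t)
  rcases le_total t 1 with h | h
  · rw [min_eq_right h]; nlinarith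
  · rw [min_eq_left h]; nlinarith

theorem integrable_min_one {μ : Measure ℝ} (h0 : μ (Iic 0) = 0)
    (h1 : ∫⁻ t, ENNReal.ofReal (min 1 t) ∂μ < ∞) : Integrable (fun t => min 1 t) μ := by
  refine ⟨by fun_prop, ?_⟩
  rw [hasFiniteIntegral_iff_ofReal]
  · exact h1
  · have : ∀ᵐ t ∂μ, t ∉ Iic (0 : ℝ) := measure_eq_zero_iff_ae_notMem.1 h0
    filter_upwards [this] with t ht
    simp at ht
    simp [ht.le]

/-- The finite measure with Laplace transform `l ↦ f (l + 2) - f (l + 1)`, when `f` is the Laplace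
exponent with drift `b` and Lévy measure `μ`. -/
noncomputable def tiltedDifference (b : ℝ) (μ : Measure ℝ) : Measure ℝ :=
  μ.withDensity (fun t => ENNReal.ofReal (Real.exp (-t) * (1 - Real.exp (-t)))) +
    ENNReal.ofReal b • Measure.dirac 0

theorem tiltedDifference_spec {f : ℝ → ℝ} {μ : Measure ℝ} {b : ℝ} (h0 : μ (Iic 0) = 0)
    (h1 : ∫⁻ t, ENNReal.ofReal (min 1 t) ∂μ < ∞) (hb : 0 ≤ b)
    (hf : ∀ l : ℝ, 0 < l → f l = b * l + ∫ t in Ioi 0, (1 - Real.exp (-l * t)) ∂μ) :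
    IsFiniteMeasure (tiltedDifference b μ) ∧
      ∀ x : ℝ, x < 1 → x ∈ integrableExpSet id (tiltedDifference b μ) ∧
        mgf id (tiltedDifference b μ) x = f (2 - x) - f (1 - x) := by
  have hpos : ∀ᵐ t ∂μ, 0 < t := by
    have : ∀ᵐ t ∂μ, t ∉ Iic (0 : ℝ) := measure_eq_zero_iff_ae_notMem.1 h0
    filter_upwards [this] with t ht
    simpa using ht
  have hμ : μ.restrict (Ioi 0) = μ := Measure.restrict_eq_self_of_ae_mem hpos
  have hmin := integrable_min_one h0 h1
  have hint : ∀ l : ℝ, 0 < l → Integrable (fun t => 1 - Real.exp (-l * t)) μ := fun l hl => by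
    refine (hmin.const_mul (1 + l)).mono' (by fun_prop) ?_
    filter_upwards [hpos] with t ht
    exact abs_one_sub_exp_neg_mul_le hl.le ht.le
  have hdiff : ∀ x : ℝ, x < 1 →
      Integrable (fun t => Real.exp (-t) * (1 - Real.exp (-t)) * Real.exp (x * t)) μ ∧
      ∫ t, Real.exp (-t) * (1 - Real.exp (-t)) * Real.exp (x * t) ∂μ + b
        = f (2 - x) - f (1 - x) := fun x hx => by
    have e : (fun t => Real.exp (-t) * (1 - Real.exp (-t)) * Real.exp (x * t)) =
        fun t => (1 - Real.exp (-(2 - x) * t)) - (1 - Real.exp (-(1 - x) * t)) := by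
      ext t
      have e1 : Real.exp (-(2 - x) * t) = Real.exp (-t) * Real.exp (-t) * Real.exp (x * t) := by
        rw [← Real.exp_add, ← Real.exp_add]; ring_nf
      have e2 : Real.exp (-(1 - x) * t) = Real.exp (-t) * Real.exp (x * t) := by
        rw [← Real.exp_add]; ring_nf
      rw [e1, e2]; ring
    have i1 := hint (2 - x) (by linarith)
    have i2 := hint (1 - x) (by linarith)
    rw [e]
    refine ⟨i1.sub i2, ?_⟩
    rw [integral_sub i1 i2, hf _ (by linarith), hf _ (by linarith), hμ]
    ring
  have hdens : ∀ t : ℝ, 0 < t → 0 ≤ Real.exp (-t) * (1 - Real.exp (-t)) := fun t ht =>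
    mul_nonneg (Real.exp_pos _).le (by
      have : Real.exp (-t) ≤ 1 := Real.exp_le_one_iff.2 (by linarith)
      linarith)
  have hmeas : Measurable fun t : ℝ => ENNReal.ofReal (Real.exp (-t) * (1 - Real.exp (-t))) := by
    fun_prop
  have hreal : ∀ x : ℝ, (fun t => (ENNReal.ofReal (Real.exp (-t) * (1 - Real.exp (-t)))).toReal •
      Real.exp (x * t)) =ᵐ[μ] fun t => Real.exp (-t) * (1 - Real.exp (-t)) * Real.exp (x * t) :=
    fun x => by
      filter_upwards [hpos] with t ht
      rw [ENNReal.toReal_ofReal (hdens t ht), smul_eq_mul]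
  have hI : ∀ x : ℝ, x < 1 → Integrable (fun t => Real.exp (x * t))
      (μ.withDensity fun t => ENNReal.ofReal (Real.exp (-t) * (1 - Real.exp (-t)))) := fun x hx => by
    rw [integrable_withDensity_iff_integrable_smul' hmeas (by simp)]
    exact (hdiff x hx).1.congr (hreal x).symm
  have hI' : ∀ x : ℝ, Integrable (fun t => Real.exp (x * t))
      (ENNReal.ofReal b • Measure.dirac (0 : ℝ)) := fun x =>
    (integrable_dirac (by simp)).smul_measure (by simp)
  refine ⟨?_, fun x hx => ⟨?_, ?_⟩⟩
  · have : IsFiniteMeasure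
        (μ.withDensity fun t => ENNReal.ofReal (Real.exp (-t) * (1 - Real.exp (-t)))) := by
      have := hI 0 one_pos
      simp only [zero_mul, Real.exp_zero] at this
      exact (integrable_const_iff.1 this).resolve_left one_ne_zero
    have : IsFiniteMeasure (ENNReal.ofReal b • Measure.dirac (0 : ℝ)) := Measure.smul_finite _ (by simp)
    unfold tiltedDifference
    infer_instance
  · exact (hI x hx).add_measure (hI' x)
  · simp only [mgf, id, tiltedDifference]
    rw [integral_add_measure (hI x hx) (hI' x), integral_withDensity_eq_integral_toReal_smul hmeas
      (by simp), integral_congr_ae (hreal x), ← (hdiff x hx).2]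
    simp [ENNReal.toReal_ofReal hb]

/-- A Laplace exponent determines its Lévy measure. -/
theorem IsSubordinatorLevyMeasure.unique {f : ℝ → ℝ} {μ μ' : Measure ℝ}
    (h : IsSubordinatorLevyMeasure f μ) (h' : IsSubordinatorLevyMeasure f μ') : μ = μ' := by
  obtain ⟨h0, h1, b, hb, hf⟩ := h
  obtain ⟨h0', h1', b', hb', hf'⟩ := h'
  obtain ⟨hfin, hs⟩ := tiltedDifference_spec h0 h1 hb hf
  obtain ⟨hfin', hs'⟩ := tiltedDifference_spec h0' h1' hb' hf'
  have heq : tiltedDifference b μ = tiltedDifference b' μ' :=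
    ext_of_mgf_eqOn_Iio one_pos (fun x hx => (hs x hx).1) (fun x hx => (hs' x hx).1)
      fun x hx => by rw [(hs x hx).2, (hs' x hx).2]
  set w : ℝ → ℝ≥0∞ := fun t => ENNReal.ofReal (Real.exp (-t) * (1 - Real.exp (-t))) with hw
  have hwm : Measurable w := by fun_prop
  -- The atom at the origin, which carries the drift, disappears on `(0, ∞)`.
  have hrec : ∀ (c : ℝ) (ν : Measure ℝ), ν (Iic 0) = 0 →
      ((tiltedDifference c ν).restrict (Ioi 0)).withDensity (fun t => (w t)⁻¹) = ν := fun c ν hν => by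
    classical
    have hpos : ∀ᵐ t ∂ν, t ∈ Ioi (0 : ℝ) := by
      have : ∀ᵐ t ∂ν, t ∉ Iic (0 : ℝ) := measure_eq_zero_iff_ae_notMem.1 hν
      filter_upwards [this] with t ht
      simpa using ht
    have e : (tiltedDifference c ν).restrict (Ioi 0) = ν.withDensity w := by
      rw [tiltedDifference, Measure.restrict_add, Measure.restrict_smul,
        restrict_withDensity measurableSet_Ioi, Measure.restrict_eq_self_of_ae_mem hpos,
        restrict_dirac]
      simp [hw]
    rw [e, withDensity_inv_same₀ hwm.aemeasurable]
    · filter_upwards [hpos] with t ht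
      have : Real.exp (-t) < 1 := Real.exp_lt_one_iff.2 (neg_lt_zero.2 ht)
      simp only [hw, ne_eq, ENNReal.ofReal_eq_zero, not_le]
      exact mul_pos (Real.exp_pos _) (by linarith)
    · exact ae_of_all _ fun t => ENNReal.ofReal_ne_top
  rw [← hrec b μ h0, heq, hrec b' μ' h0']

/-! ### The Lévy measure of the subordinator -/

theorem continuous_Gamma_inv : Continuous fun x : ℝ => (Real.Gamma x)⁻¹ := by
  have h : (fun x : ℝ => (Real.Gamma x)⁻¹) = fun x : ℝ => ((Complex.Gamma x)⁻¹).re := by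
    ext x
    rw [Complex.Gamma_ofReal, ← Complex.ofReal_inv, Complex.ofReal_re]
  rw [h]
  exact Complex.continuous_re.comp
    (Complex.differentiable_one_div_Gamma.continuous.comp Complex.continuous_ofReal)

/-- The weight `(1 - u) / Γ(1 + u)`; multiplied by `u` it is `(1 - u) / Γ(u)`, the constant in the
Lévy density of the `(1 - u)`-stable subordinator. -/
noncomputable def stableWeight (u : ℝ) : ℝ := (1 - u) * (Real.Gamma (1 + u))⁻¹

theorem continuous_stableWeight : Continuous stableWeight :=
  (continuous_const.sub continuous_id).mul
    (continuous_Gamma_inv.comp (continuous_const.add continuous_id))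

theorem stableWeight_nonneg {u : ℝ} (h0 : 0 ≤ u) (h1 : u ≤ 1) : 0 ≤ stableWeight u :=
  mul_nonneg (by linarith) (inv_nonneg.2 (Real.Gamma_pos_of_pos (by linarith)).le)

theorem exists_stableWeight_le : ∃ C : ℝ, 0 < C ∧ ∀ u ∈ Icc (0 : ℝ) 1, |stableWeight u| ≤ C := by
  obtain ⟨C, hC⟩ := isCompact_Icc.exists_bound_of_continuousOn
    (continuous_stableWeight.continuousOn (s := Icc (0 : ℝ) 1))
  exact ⟨max C 1, by positivity, fun u hu => (hC u hu).trans (le_max_left _ _)⟩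

/-- The Lévy density `e^{-t} (1 - u) / Γ(u) t^{u - 2}` of the subordinator with Laplace exponent
`l ↦ (1 + l)^{1 - u} - 1`. -/
noncomputable def relativisticDensity (u t : ℝ) : ℝ :=
  Real.exp (-t) * (u * stableWeight u * t ^ (u - 2))

theorem relativisticDensity_nonneg {u t : ℝ} (h0 : 0 ≤ u) (h1 : u ≤ 1) (ht : 0 ≤ t) :
    0 ≤ relativisticDensity u t :=
  mul_nonneg (Real.exp_pos _).le
    (mul_nonneg (mul_nonneg h0 (stableWeight_nonneg h0 h1)) (Real.rpow_nonneg ht _))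

theorem measurable_relativisticDensity :
    Measurable fun p : ℝ × ℝ => relativisticDensity p.1 p.2 := by
  have := continuous_stableWeight.measurable
  unfold relativisticDensity
  fun_prop

theorem integral_exp_neg_mul_eq (l t : ℝ) :
    ∫ v in (0 : ℝ)..l, t * Real.exp (-v * t) = 1 - Real.exp (-l * t) := by
  have h : ∀ v ∈ uIcc 0 l, HasDerivAt (fun v => -Real.exp (-v * t)) (t * Real.exp (-v * t)) v :=
    fun v _ => by
      have := (((hasDerivAt_id v).neg.mul_const t).exp).neg
      refine this.congr_deriv ?_
      simp; ring
  rw [intervalIntegral.integral_eq_sub_of_hasDerivAt h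
    (Continuous.intervalIntegrable (by fun_prop) _ _)]
  simp; ring

/-- The `v`-derivative of the identity `lintegral_one_sub_exp_mul_relativisticDensity`; the integral
is a Gamma integral. -/
theorem lintegral_relativisticDensity_mul_exp {u v : ℝ} (hu : u ∈ Ioo (0 : ℝ) 1) (hv : 0 ≤ v) :
    ∫⁻ t in Ioi 0, ENNReal.ofReal (t * Real.exp (-v * t) * relativisticDensity u t) =
      ENNReal.ofReal ((1 - u) * (1 + v) ^ (-u)) := by
  have hG := Real.integral_rpow_mul_exp_neg_mul_Ioi hu.1 (show 0 < 1 + v by linarith)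
  have hpos : 0 < (1 / (1 + v)) ^ u * Real.Gamma u :=
    mul_pos (by positivity) (Real.Gamma_pos_of_pos hu.1)
  have hint : IntegrableOn (fun t : ℝ => t ^ (u - 1) * Real.exp (-((1 + v) * t))) (Ioi 0) := by
    by_contra h
    rw [integral_undef h] at hG
    exact hpos.ne hG
  have hw : 0 ≤ u * stableWeight u := mul_nonneg hu.1.le (stableWeight_nonneg hu.1.le hu.2.le)
  calc ∫⁻ t in Ioi 0, ENNReal.ofReal (t * Real.exp (-v * t) * relativisticDensity u t)
      = ∫⁻ t in Ioi 0, ENNReal.ofReal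
          (u * stableWeight u * (t ^ (u - 1) * Real.exp (-((1 + v) * t)))) := by
        refine setLIntegral_congr_fun measurableSet_Ioi fun t ht => ?_
        have ht : 0 < t := ht
        have e1 : t ^ (u - 1) = t * t ^ (u - 2) := by
          rw [show u - 1 = 1 + (u - 2) by ring, Real.rpow_add ht, Real.rpow_one]
        have e2 : Real.exp (-((1 + v) * t)) = Real.exp (-v * t) * Real.exp (-t) := by
          rw [← Real.exp_add]; ring_nf
        simp only [relativisticDensity, e1, e2]
        ring_nf
    _ = ENNReal.ofReal (∫ t in Ioi 0,
          u * stableWeight u * (t ^ (u - 1) * Real.exp (-((1 + v) * t)))) := by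
        rw [ofReal_integral_eq_lintegral_ofReal (hint.const_mul _)]
        filter_upwards [ae_restrict_mem measurableSet_Ioi] with t ht
        exact mul_nonneg hw (mul_nonneg (Real.rpow_nonneg (le_of_lt ht) _) (Real.exp_pos _).le)
    _ = _ := by
        congr 1
        rw [integral_const_mul, hG, stableWeight, add_comm 1 u, Real.Gamma_add_one hu.1.ne',
          one_div, Real.inv_rpow (by linarith), ← Real.rpow_neg (by linarith)]
        have := (Real.Gamma_pos_of_pos hu.1).ne'
        have := hu.1.ne'
        field_simp

/-- `relativisticDensity u` is the Lévy density for the Laplace exponent `l ↦ (1 + l)^{1 - u} - 1`. -/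
theorem lintegral_one_sub_exp_mul_relativisticDensity {u l : ℝ} (hu : u ∈ Ioo (0 : ℝ) 1)
    (hl : 0 ≤ l) :
    ∫⁻ t in Ioi 0, ENNReal.ofReal ((1 - Real.exp (-l * t)) * relativisticDensity u t) =
      ENNReal.ofReal ((1 + l) ^ (1 - u) - 1) := by
  have hk := measurable_relativisticDensity
  calc ∫⁻ t in Ioi 0, ENNReal.ofReal ((1 - Real.exp (-l * t)) * relativisticDensity u t)
      = ∫⁻ t in Ioi 0, ∫⁻ v in Ioc 0 l,
          ENNReal.ofReal (t * Real.exp (-v * t) * relativisticDensity u t) := by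
        refine setLIntegral_congr_fun measurableSet_Ioi fun t ht => ?_
        have ht : 0 < t := ht
        rw [← integral_exp_neg_mul_eq l t, intervalIntegral.integral_of_le hl,
          ← integral_mul_const, ofReal_integral_eq_lintegral_ofReal]
        · exact (Continuous.integrableOn_Icc (by fun_prop)).mono_set Ioc_subset_Icc_self
        · exact ae_of_all _ fun v => mul_nonneg (mul_nonneg ht.le (Real.exp_pos _).le)
            (relativisticDensity_nonneg hu.1.le hu.2.le ht.le)
    _ = ∫⁻ v in Ioc 0 l, ∫⁻ t in Ioi 0,
          ENNReal.ofReal (t * Real.exp (-v * t) * relativisticDensity u t) := by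
        refine lintegral_lintegral_swap (Measurable.aemeasurable ?_)
        have : Measurable fun p : ℝ × ℝ => relativisticDensity u p.1 :=
          hk.comp (measurable_const.prodMk measurable_fst)
        simp only [Function.uncurry_def]
        fun_prop
    _ = ∫⁻ v in Ioc 0 l, ENNReal.ofReal ((1 - u) * (1 + v) ^ (-u)) :=
        setLIntegral_congr_fun measurableSet_Ioc fun v hv =>
          lintegral_relativisticDensity_mul_exp hu hv.1.le
    _ = ENNReal.ofReal (∫ v in (0 : ℝ)..l, (1 - u) * (1 + v) ^ (-u)) := by
        rw [intervalIntegral.integral_of_le hl, ofReal_integral_eq_lintegral_ofReal]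
        · refine (ContinuousOn.integrableOn_Icc ?_).mono_set Ioc_subset_Icc_self
          refine continuousOn_const.mul (ContinuousOn.rpow_const (by fun_prop) fun v hv => ?_)
          left; linarith [hv.1]
        · filter_upwards [ae_restrict_mem measurableSet_Ioc] with v hv
          exact mul_nonneg (by linarith [hu.2]) (Real.rpow_nonneg (by linarith [hv.1]) _)
    _ = _ := by
        congr 1
        have h : ∀ v ∈ uIcc 0 l,
            HasDerivAt (fun v => (1 + v) ^ (1 - u)) ((1 - u) * (1 + v) ^ (-u)) v := fun v hv => by
          rw [uIcc_of_le hl] at hv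
          have := ((hasDerivAt_id v).const_add 1).rpow_const (p := 1 - u)
            (Or.inl (by simp only [id]; linarith [hv.1]))
          refine this.congr_deriv ?_
          simp [show 1 - u - 1 = -u by ring]
        rw [intervalIntegral.integral_eq_sub_of_hasDerivAt h]
        · simp
        · rw [intervalIntegrable_iff_integrableOn_Icc_of_le hl]
          refine ContinuousOn.integrableOn_Icc ?_
          refine continuousOn_const.mul (ContinuousOn.rpow_const (by fun_prop) fun v hv => ?_)
          left; linarith [hv.1]

/-- `l / log (1 + l) - 1 = ∫₀¹ ((1 + l)^{1 - u} - 1) du`. -/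
theorem lintegral_one_add_rpow_sub_one {l : ℝ} (hl : 0 < l) :
    ∫⁻ u in Ioo (0 : ℝ) 1, ENNReal.ofReal ((1 + l) ^ (1 - u) - 1) = ENNReal.ofReal (phi l) := by
  have hlog : Real.log (1 + l) ≠ 0 := (Real.log_pos (by linarith)).ne'
  have hcont : Continuous fun u : ℝ => (1 + l) ^ (1 - u) - 1 :=
    ((Real.continuous_const_rpow (by linarith)).comp (by fun_prop)).sub continuous_const
  have h : ∀ u ∈ uIcc (0 : ℝ) 1, HasDerivAt
      (fun u => -(1 + l) ^ (1 - u) / Real.log (1 + l) - u) ((1 + l) ^ (1 - u) - 1) u := fun u _ => by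
    have h1 : HasDerivAt (fun u : ℝ => 1 - u) (-1) u := by
      simpa using (hasDerivAt_id u).const_sub 1
    have := ((h1.const_rpow (a := 1 + l) (by linarith)).neg.div_const (Real.log (1 + l))).sub
      (hasDerivAt_id u)
    refine this.congr_deriv ?_
    field_simp
  have hI := intervalIntegral.integral_eq_sub_of_hasDerivAt h (hcont.intervalIntegrable _ _)
  rw [intervalIntegral.integral_of_le zero_le_one, integral_Ioc_eq_integral_Ioo] at hI
  rw [← ofReal_integral_eq_lintegral_ofReal, hI]
  · congr 1
    simp only [phi, hl.ne', if_false]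
    simp
    field_simp
    ring
  · exact hcont.integrableOn_Icc.mono_set Ioo_subset_Icc_self
  · filter_upwards [ae_restrict_mem measurableSet_Ioo] with u hu
    have : 1 ≤ (1 + l) ^ (1 - u) := Real.one_le_rpow (by linarith) (by linarith [hu.2])
    simpa using this

/-- The Lévy density of the subordinator with Laplace exponent `phi`. -/
noncomputable def subordinatorDensity (t : ℝ) : ℝ := ∫ u in Ioo (0 : ℝ) 1, relativisticDensity u t

/-- The measure on `(0, ∞)` with density `subordinatorDensity`. -/
noncomputable def subordinatorMeasure : Measure ℝ :=
  (volume.restrict (Ioi 0)).withDensity fun t => ENNReal.ofReal (subordinatorDensity t)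

theorem continuous_relativisticDensity {t : ℝ} (ht : 0 < t) :
    Continuous fun u => relativisticDensity u t := by
  have := continuous_stableWeight
  have : Continuous fun u : ℝ => t ^ (u - 2) :=
    (Real.continuous_const_rpow ht.ne').comp (by fun_prop)
  unfold relativisticDensity
  fun_prop

theorem subordinatorDensity_nonneg {t : ℝ} (ht : 0 ≤ t) : 0 ≤ subordinatorDensity t :=
  setIntegral_nonneg measurableSet_Ioo fun _ hu => relativisticDensity_nonneg hu.1.le hu.2.le ht

theorem measurable_subordinatorDensity : Measurable subordinatorDensity :=
  (measurable_relativisticDensity.comp measurable_swap).stronglyMeasurable.integral_prod_right'.measurable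

theorem ofReal_subordinatorDensity {t : ℝ} (ht : 0 < t) :
    ENNReal.ofReal (subordinatorDensity t) =
      ∫⁻ u in Ioo (0 : ℝ) 1, ENNReal.ofReal (relativisticDensity u t) := by
  refine ofReal_integral_eq_lintegral_ofReal ?_ ?_
  · exact (continuous_relativisticDensity ht).integrableOn_Icc.mono_set Ioo_subset_Icc_self
  · filter_upwards [ae_restrict_mem measurableSet_Ioo] with u hu
    exact relativisticDensity_nonneg hu.1.le hu.2.le ht.le

theorem ae_subordinatorMeasure_pos : ∀ᵐ t ∂subordinatorMeasure, 0 < t :=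
  (withDensity_absolutelyContinuous _ _).ae_le (ae_restrict_mem measurableSet_Ioi)

theorem lintegral_one_sub_exp_subordinatorMeasure {l : ℝ} (hl : 0 ≤ l) :
    ∫⁻ t, ENNReal.ofReal (1 - Real.exp (-l * t)) ∂subordinatorMeasure = ENNReal.ofReal (phi l) := by
  rcases hl.eq_or_lt with rfl | hl
  · simp [phi]
  have hk := measurable_relativisticDensity
  rw [subordinatorMeasure, lintegral_withDensity_eq_lintegral_mul _
    measurable_subordinatorDensity.ennreal_ofReal (by fun_prop)]
  calc ∫⁻ t in Ioi 0, ((fun t => ENNReal.ofReal (subordinatorDensity t)) *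
        fun t => ENNReal.ofReal (1 - Real.exp (-l * t))) t
      = ∫⁻ t in Ioi 0, ∫⁻ u in Ioo (0 : ℝ) 1,
          ENNReal.ofReal ((1 - Real.exp (-l * t)) * relativisticDensity u t) := by
        refine setLIntegral_congr_fun measurableSet_Ioi fun t ht => ?_
        have ht : 0 < t := ht
        have h1 : 0 ≤ 1 - Real.exp (-l * t) := by
          have : Real.exp (-l * t) ≤ 1 := Real.exp_le_one_iff.2 (by nlinarith)
          linarith
        simp only [Pi.mul_apply, ofReal_subordinatorDensity ht, ENNReal.ofReal_mul h1]
        rw [lintegral_const_mul, mul_comm]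
        exact (hk.comp (measurable_id.prodMk measurable_const)).ennreal_ofReal
    _ = ∫⁻ u in Ioo (0 : ℝ) 1, ∫⁻ t in Ioi 0,
          ENNReal.ofReal ((1 - Real.exp (-l * t)) * relativisticDensity u t) := by
        refine lintegral_lintegral_swap (Measurable.aemeasurable ?_)
        have : Measurable fun p : ℝ × ℝ => relativisticDensity p.2 p.1 := hk.comp measurable_swap
        simp only [Function.uncurry_def]
        fun_prop
    _ = ∫⁻ u in Ioo (0 : ℝ) 1, ENNReal.ofReal ((1 + l) ^ (1 - u) - 1) :=
        setLIntegral_congr_fun measurableSet_Ioo fun u hu =>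
          lintegral_one_sub_exp_mul_relativisticDensity hu hl.le
    _ = _ := lintegral_one_add_rpow_sub_one hl

theorem lintegral_min_one_subordinatorMeasure_lt_top :
    ∫⁻ t, ENNReal.ofReal (min 1 t) ∂subordinatorMeasure < ∞ := by
  calc ∫⁻ t, ENNReal.ofReal (min 1 t) ∂subordinatorMeasure
      ≤ ∫⁻ t, ENNReal.ofReal 2 * ENNReal.ofReal (1 - Real.exp (-1 * t)) ∂subordinatorMeasure := by
        refine lintegral_mono_ae ?_
        filter_upwards [ae_subordinatorMeasure_pos] with t ht
        rw [← ENNReal.ofReal_mul two_pos.le, neg_one_mul]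
        exact ENNReal.ofReal_le_ofReal (min_one_le_two_mul_one_sub_exp_neg ht.le)
    _ < ∞ := by
        rw [lintegral_const_mul _ (by fun_prop),
          lintegral_one_sub_exp_subordinatorMeasure zero_le_one]
        exact ENNReal.mul_lt_top (by simp) (by simp)

theorem phi_nonneg {l : ℝ} (hl : 0 ≤ l) : 0 ≤ phi l := by
  rcases hl.eq_or_lt with rfl | hl
  · simp [phi]
  have h1 : 0 < Real.log (1 + l) := Real.log_pos (by linarith)
  have h2 : Real.log (1 + l) ≤ l := by linarith [Real.log_le_sub_one_of_pos (show 0 < 1 + l by linarith)]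
  simp only [phi, hl.ne', if_false, sub_nonneg]
  rwa [le_div_iff₀ h1, one_mul]

theorem isSubordinatorLevyMeasure_subordinatorMeasure :
    IsSubordinatorLevyMeasure phi subordinatorMeasure := by
  refine ⟨?_, lintegral_min_one_subordinatorMeasure_lt_top, 0, le_rfl, fun l hl => ?_⟩
  · rw [measure_eq_zero_iff_ae_notMem]
    filter_upwards [ae_subordinatorMeasure_pos] with t ht
    simpa using ht
  · have hres : subordinatorMeasure.restrict (Ioi 0) = subordinatorMeasure :=
      Measure.restrict_eq_self_of_ae_mem ae_subordinatorMeasure_pos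
    rw [hres,
      integral_eq_lintegral_of_nonneg_ae _ (by fun_prop),
      lintegral_one_sub_exp_subordinatorMeasure hl.le, ENNReal.toReal_ofReal (phi_nonneg hl.le)]
    · ring
    · filter_upwards [ae_subordinatorMeasure_pos] with t ht
      have : Real.exp (-l * t) ≤ 1 := Real.exp_le_one_iff.2 (by nlinarith)
      simpa using this

/-! ### Subordination of the heat kernel and the Lévy triplet -/

/-- The heat kernel of `∂ₜ = Δ` on `ℝ^d` at time `t` and distance `r` from the origin. -/
noncomputable def heatKernel (d : ℕ) (t r : ℝ) : ℝ :=
  (4 * Real.pi) ^ (-(d : ℝ) / 2) * (t ^ (-(d : ℝ) / 2) * Real.exp (-r ^ 2 / (4 * t)))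

theorem heatKernel_nonneg (d : ℕ) {t : ℝ} (ht : 0 ≤ t) (r : ℝ) : 0 ≤ heatKernel d t r := by
  unfold heatKernel
  positivity

theorem measurable_heatKernel (d : ℕ) : Measurable fun p : ℝ × ℝ => heatKernel d p.1 p.2 := by
  unfold heatKernel
  fun_prop

theorem heatKernel_eq (d : ℕ) {t : ℝ} (ht : 0 < t) (r : ℝ) :
    heatKernel d t r = ((4 * Real.pi * t) ^ ((d : ℝ) / 2))⁻¹ * Real.exp (-(1 / (4 * t)) * r ^ 2) := by
  have := Real.pi_pos
  rw [heatKernel, ← mul_assoc, ← Real.mul_rpow (by positivity) ht.le, neg_div,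
    Real.rpow_neg (by positivity)]
  congr 2
  field_simp

section Gaussian

variable {d : ℕ}

local notation "E" => EuclideanSpace ℝ (Fin d)

theorem integrable_exp_neg_mul_sq_norm {b : ℝ} (hb : 0 < b) :
    Integrable fun v : E => Real.exp (-b * ‖v‖ ^ 2) := by
  by_contra h
  have := GaussianFourier.integral_rexp_neg_mul_sq_norm (V := E) hb
  rw [integral_undef h] at this
  have h2 : 0 < (Real.pi / b) ^ ((Module.finrank ℝ E : ℝ) / 2) :=
    Real.rpow_pos_of_pos (div_pos Real.pi_pos hb) _
  exact h2.ne this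

theorem integral_exp_neg_mul_sq_norm_mul_cos {b : ℝ} (hb : 0 < b) (ξ : E) :
    ∫ v : E, Real.exp (-b * ‖v‖ ^ 2) * Real.cos (inner ℝ v ξ) =
      (Real.pi / b) ^ ((d : ℝ) / 2) * Real.exp (-‖ξ‖ ^ 2 / (4 * b)) := by
  have h := GaussianFourier.integral_cexp_neg_mul_sq_norm_add (V := E) (b := (b : ℂ))
    (by simpa using hb) Complex.I ξ
  have h1 : ∀ v : E, Complex.exp (-(b : ℂ) * (‖v‖ : ℂ) ^ 2 + Complex.I * ((inner ℝ ξ v : ℝ) : ℂ)) =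
      (Real.exp (-b * ‖v‖ ^ 2) : ℂ) * Complex.exp (((inner ℝ v ξ : ℝ) : ℂ) * Complex.I) := fun v => by
    rw [Complex.exp_add, real_inner_comm, mul_comm Complex.I]
    push_cast
    rfl
  have hi : Integrable fun v : E =>
      (Real.exp (-b * ‖v‖ ^ 2) : ℂ) * Complex.exp (((inner ℝ v ξ : ℝ) : ℂ) * Complex.I) := by
    refine (integrable_exp_neg_mul_sq_norm hb).mono' (by fun_prop) (ae_of_all _ fun v => ?_)
    rw [norm_mul, Complex.norm_exp_ofReal_mul_I, mul_one, Complex.norm_real, Real.norm_eq_abs,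
      abs_of_pos (Real.exp_pos _)]
  have h2 := congrArg Complex.re h
  simp_rw [h1] at h2
  have h3 := integral_re hi
  simp only [RCLike.re_eq_complex_re, Complex.re_ofReal_mul, Complex.exp_ofReal_mul_I_re] at h3
  rw [h3, h2]
  have h4 : ((Real.pi : ℂ) / b) ^ ((Module.finrank ℝ E : ℂ) / 2) =
      (((Real.pi / b) ^ ((d : ℝ) / 2) : ℝ) : ℂ) := by
    rw [Complex.ofReal_cpow (div_pos Real.pi_pos hb).le]
    simp
  have h5 : Complex.exp (Complex.I ^ 2 * (‖ξ‖ : ℂ) ^ 2 / (4 * b)) =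
      ((Real.exp (-‖ξ‖ ^ 2 / (4 * b)) : ℝ) : ℂ) := by
    push_cast
    simp
  rw [h4, h5, ← Complex.ofReal_mul, Complex.ofReal_re]

theorem integrable_heatKernel {t : ℝ} (ht : 0 < t) :
    Integrable fun v : E => heatKernel d t ‖v‖ := by
  simp_rw [heatKernel_eq d ht]
  exact (integrable_exp_neg_mul_sq_norm (by positivity)).const_mul _

theorem integral_heatKernel_mul_cos {t : ℝ} (ht : 0 < t) (ξ : E) :
    ∫ v : E, heatKernel d t ‖v‖ * Real.cos (inner ℝ v ξ) = Real.exp (-t * ‖ξ‖ ^ 2) := by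
  have := Real.pi_pos
  simp_rw [heatKernel_eq d ht, mul_assoc]
  rw [integral_const_mul, integral_exp_neg_mul_sq_norm_mul_cos (by positivity)]
  have e : Real.pi / (1 / (4 * t)) = 4 * Real.pi * t := by field_simp
  rw [e, ← mul_assoc, ← mul_assoc 4, inv_mul_cancel₀ (by positivity), one_mul]
  congr 1
  field_simp

theorem integral_heatKernel {t : ℝ} (ht : 0 < t) : ∫ v : E, heatKernel d t ‖v‖ = 1 := by
  simpa using integral_heatKernel_mul_cos ht (0 : E)

theorem lintegral_one_sub_cos_mul_heatKernel {t : ℝ} (ht : 0 < t) (ξ : E) :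
    ∫⁻ v : E, ENNReal.ofReal ((1 - Real.cos (inner ℝ v ξ)) * heatKernel d t ‖v‖) =
      ENNReal.ofReal (1 - Real.exp (-‖ξ‖ ^ 2 * t)) := by
  have hi : Integrable fun v : E => heatKernel d t ‖v‖ * Real.cos (inner ℝ v ξ) := by
    refine (integrable_heatKernel ht).mono'
      ((integrable_heatKernel ht).aestronglyMeasurable.mul (by fun_prop)) (ae_of_all _ fun v => ?_)
    rw [norm_mul, Real.norm_eq_abs, Real.norm_eq_abs, abs_of_nonneg (heatKernel_nonneg d ht.le _)]
    exact mul_le_of_le_one_right (heatKernel_nonneg d ht.le _) (Real.abs_cos_le_one _)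
  have e : (fun v : E => (1 - Real.cos (inner ℝ v ξ)) * heatKernel d t ‖v‖) =
      fun v => heatKernel d t ‖v‖ - heatKernel d t ‖v‖ * Real.cos (inner ℝ v ξ) := by
    ext v; ring
  rw [← ofReal_integral_eq_lintegral_ofReal]
  · rw [e, integral_sub (integrable_heatKernel ht) hi, integral_heatKernel ht,
      integral_heatKernel_mul_cos ht]
    ring_nf
  · rw [e]
    exact (integrable_heatKernel ht).sub hi
  · exact ae_of_all _ fun v => mul_nonneg (by linarith [Real.cos_le_one (inner ℝ v ξ)])
      (heatKernel_nonneg d ht.le _)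

/-- The truncated second moment of the heat kernel at time `t` is `O(1 ∧ t)`; this carries the
integrability of the subordinator's Lévy measure over to `ℝ^d`. -/
theorem lintegral_min_one_sq_mul_heatKernel_le {t : ℝ} (ht : 0 < t) :
    ∫⁻ v : E, ENNReal.ofReal (min 1 (‖v‖ ^ 2) * heatKernel d t ‖v‖) ≤
      ENNReal.ofReal (8 * 2 ^ ((d : ℝ) / 2) * min 1 t) := by
  have hpi := Real.pi_pos
  have hC : 1 ≤ (2 : ℝ) ^ ((d : ℝ) / 2) := Real.one_le_rpow one_le_two (by positivity)
  have hle : ∀ g : E → ℝ, Integrable g → (∀ v, min 1 (‖v‖ ^ 2) * heatKernel d t ‖v‖ ≤ g v) →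
      (∀ v, 0 ≤ g v) → ∫⁻ v : E, ENNReal.ofReal (min 1 (‖v‖ ^ 2) * heatKernel d t ‖v‖) ≤
        ENNReal.ofReal (∫ v, g v) := fun g hg h h0 => by
    rw [ofReal_integral_eq_lintegral_ofReal hg (ae_of_all _ h0)]
    exact lintegral_mono fun v => ENNReal.ofReal_le_ofReal (h v)
  rcases le_total t 1 with h1 | h1
  · rw [min_eq_right h1]
    -- `|v|² ≤ 8 t exp (|v|² / (8 t))` turns the second moment into another Gaussian integral.
    have hb : 0 < 1 / (8 * t) := by positivity
    have hg : Integrable fun v : E => 8 * t * ((4 * Real.pi * t) ^ ((d : ℝ) / 2))⁻¹ *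
        Real.exp (-(1 / (8 * t)) * ‖v‖ ^ 2) := (integrable_exp_neg_mul_sq_norm hb).const_mul _
    refine (hle _ hg (fun v => ?_) fun v => by positivity).trans (le_of_eq ?_)
    · rw [heatKernel_eq d ht]
      have e : Real.exp (-(1 / (4 * t)) * ‖v‖ ^ 2) =
          Real.exp (-(1 / (8 * t)) * ‖v‖ ^ 2) * Real.exp (-(1 / (8 * t)) * ‖v‖ ^ 2) := by
        rw [← Real.exp_add]; congr 1; field_simp; ring
      have h2 : ‖v‖ ^ 2 * Real.exp (-(1 / (8 * t)) * ‖v‖ ^ 2) ≤ 8 * t := by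
        have h3 := Real.add_one_le_exp (1 / (8 * t) * ‖v‖ ^ 2)
        rw [neg_mul, Real.exp_neg, ← div_eq_mul_inv, div_le_iff₀ (Real.exp_pos _)]
        calc ‖v‖ ^ 2 = 8 * t * (1 / (8 * t) * ‖v‖ ^ 2) := by field_simp
          _ ≤ _ := by gcongr; linarith
      calc min 1 (‖v‖ ^ 2) * (((4 * Real.pi * t) ^ ((d : ℝ) / 2))⁻¹ *
            Real.exp (-(1 / (4 * t)) * ‖v‖ ^ 2))
          ≤ ‖v‖ ^ 2 * (((4 * Real.pi * t) ^ ((d : ℝ) / 2))⁻¹ *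
            Real.exp (-(1 / (4 * t)) * ‖v‖ ^ 2)) := by gcongr; exact min_le_right _ _
        _ = (‖v‖ ^ 2 * Real.exp (-(1 / (8 * t)) * ‖v‖ ^ 2)) * ((4 * Real.pi * t) ^ ((d : ℝ) / 2))⁻¹ *
            Real.exp (-(1 / (8 * t)) * ‖v‖ ^ 2) := by rw [e]; ring
        _ ≤ _ := by gcongr
    · rw [integral_const_mul, GaussianFourier.integral_rexp_neg_mul_sq_norm hb]
      have e : Real.pi / (1 / (8 * t)) = 2 * (4 * Real.pi * t) := by field_simp; ring
      rw [e, Real.mul_rpow two_pos.le (by positivity)]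
      have : (4 * Real.pi * t) ^ ((d : ℝ) / 2) ≠ 0 := by positivity
      simp only [finrank_euclideanSpace, Fintype.card_fin]
      congr 1
      field_simp
  · rw [min_eq_left h1]
    refine (hle _ (integrable_heatKernel ht) (fun v => ?_) fun v => heatKernel_nonneg d ht.le _).trans
      ?_
    · exact mul_le_of_le_one_left (heatKernel_nonneg d ht.le _) (min_le_left _ _)
    · rw [integral_heatKernel ht]
      exact ENNReal.ofReal_le_ofReal (by linarith)

/-- The density at `y` of the Lévy measure obtained by mixing the heat kernels over
`subordinatorMeasure`. -/
noncomputable def mixedDensity (y : E) : ℝ≥0∞ :=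
  ∫⁻ t, ENNReal.ofReal (heatKernel d t ‖y‖) ∂subordinatorMeasure

instance : SFinite subordinatorMeasure := by
  unfold subordinatorMeasure
  infer_instance

theorem measurable_mixedDensity : Measurable (mixedDensity : E → ℝ≥0∞) := by
  unfold mixedDensity
  refine Measurable.lintegral_prod_right' (f := fun p : E × ℝ =>
    ENNReal.ofReal (heatKernel d p.2 ‖p.1‖)) ?_
  exact ((measurable_heatKernel d).comp
    (measurable_snd.prodMk measurable_fst.norm)).ennreal_ofReal

theorem lintegral_mul_mixedDensity {F : E → ℝ} (hF : Measurable F) (h0 : ∀ y, 0 ≤ F y) :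
    ∫⁻ y, mixedDensity y * ENNReal.ofReal (F y) =
      ∫⁻ t, (∫⁻ y : E, ENNReal.ofReal (F y * heatKernel d t ‖y‖)) ∂subordinatorMeasure := by
  have hk : Measurable fun p : E × ℝ => heatKernel d p.2 ‖p.1‖ :=
    (measurable_heatKernel d).comp (measurable_snd.prodMk measurable_fst.norm)
  rw [← lintegral_lintegral_swap]
  · refine lintegral_congr fun y => ?_
    simp_rw [ENNReal.ofReal_mul (h0 y)]
    rw [lintegral_const_mul, mul_comm, mixedDensity]
    exact (hk.comp (measurable_const.prodMk measurable_id)).ennreal_ofReal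
  · refine Measurable.aemeasurable ?_
    simp only [Function.uncurry_def]
    fun_prop

theorem lintegral_mixedDensity_mul_min_one_sq_lt_top :
    ∫⁻ y : E, mixedDensity y * ENNReal.ofReal (min 1 (‖y‖ ^ 2)) < ∞ := by
  rw [lintegral_mul_mixedDensity (by fun_prop) fun y => by positivity]
  calc _ ≤ ∫⁻ t, ENNReal.ofReal (8 * 2 ^ ((d : ℝ) / 2)) * ENNReal.ofReal (min 1 t)
        ∂subordinatorMeasure := by
        refine lintegral_mono_ae ?_
        filter_upwards [ae_subordinatorMeasure_pos] with t ht
        rw [← ENNReal.ofReal_mul (by positivity)]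
        exact lintegral_min_one_sq_mul_heatKernel_le ht
    _ < ∞ := by
        rw [lintegral_const_mul _ (by fun_prop)]
        exact ENNReal.mul_lt_top ENNReal.ofReal_lt_top lintegral_min_one_subordinatorMeasure_lt_top

theorem lintegral_mixedDensity_mul_one_sub_cos (ξ : E) :
    ∫⁻ y : E, mixedDensity y * ENNReal.ofReal (1 - Real.cos (inner ℝ y ξ)) =
      ENNReal.ofReal (phi (‖ξ‖ ^ 2)) := by
  rw [lintegral_mul_mixedDensity (by fun_prop)
    fun y => by linarith [Real.cos_le_one (inner ℝ y ξ)],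
    ← lintegral_one_sub_exp_subordinatorMeasure (sq_nonneg _)]
  refine lintegral_congr_ae ?_
  filter_upwards [ae_subordinatorMeasure_pos] with t ht
  exact lintegral_one_sub_cos_mul_heatKernel ht ξ

theorem radialLevyDensity_eq (r : ℝ) :
    radialLevyDensity d subordinatorMeasure r = ∫ t, heatKernel d t r ∂subordinatorMeasure := by
  have hres : subordinatorMeasure.restrict (Ioi 0) = subordinatorMeasure :=
    Measure.restrict_eq_self_of_ae_mem ae_subordinatorMeasure_pos
  rw [radialLevyDensity, hres, ← integral_const_mul]
  rfl

/-- Finiteness almost everywhere follows from the finite integral against `1 ∧ |y|²`; for `d ≥ 1` the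
origin, where that weight vanishes, is a null set. -/
theorem ae_mixedDensity_lt_top (hd : 1 ≤ d) : ∀ᵐ y : E, mixedDensity y < ∞ := by
  have : NeZero d := ⟨by omega⟩
  have h := ae_lt_top (measurable_mixedDensity.mul (by fun_prop))
    (lintegral_mixedDensity_mul_min_one_sq_lt_top (d := d)).ne
  filter_upwards [h, Measure.ae_ne volume (0 : E)] with y hy h0
  by_contra hc
  rw [not_lt, top_le_iff] at hc
  rw [Pi.mul_apply, hc, ENNReal.top_mul] at hy
  · exact lt_irrefl _ hy
  · have : 0 < ‖y‖ := norm_pos_iff.2 h0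
    simp only [ne_eq, ENNReal.ofReal_eq_zero, not_le]
    positivity

/-- The radial Lévy density is given by a convergent integral at almost every point. -/
theorem ae_ofReal_radialLevyDensity (hd : 1 ≤ d) :
    ∀ᵐ y : E, ENNReal.ofReal (radialLevyDensity d subordinatorMeasure ‖y‖) = mixedDensity y := by
  filter_upwards [ae_mixedDensity_lt_top hd] with y hy
  have hm : Measurable fun t => heatKernel d t ‖y‖ :=
    (measurable_heatKernel d).comp (measurable_id.prodMk measurable_const)
  rw [radialLevyDensity_eq, integral_eq_lintegral_of_nonneg_ae _ hm.aestronglyMeasurable]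
  · exact ENNReal.ofReal_toReal hy.ne
  · filter_upwards [ae_subordinatorMeasure_pos] with t ht
    exact heatKernel_nonneg d ht.le _

theorem withDensity_radialLevyDensity (hd : 1 ≤ d) :
    (volume : Measure E).withDensity
      (fun y => ENNReal.ofReal (radialLevyDensity d subordinatorMeasure ‖y‖)) =
      volume.withDensity mixedDensity :=
  withDensity_congr_ae (ae_ofReal_radialLevyDensity hd)

theorem isLevyMeasure_mixedDensity (hd : 1 ≤ d) :
    IsLevyMeasure ((volume : Measure E).withDensity mixedDensity) := by
  have : NeZero d := ⟨by omega⟩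
  refine ⟨withDensity_absolutelyContinuous _ _ (measure_singleton 0), ?_⟩
  rw [lintegral_withDensity_eq_lintegral_mul _ measurable_mixedDensity (by fun_prop)]
  exact lintegral_mixedDensity_mul_min_one_sq_lt_top

/-- The integrand of the Lévy–Khintchine formula. -/
noncomputable def levyIntegrand (ξ y : E) : ℂ :=
  Complex.exp (Complex.I * (inner ℝ y ξ : ℝ)) - 1
    - Complex.I * (({y | ‖y‖ < 1} : Set E).indicator (fun y => inner ℝ y ξ) y : ℝ)

theorem norm_exp_sub_one_sub_le (x : ℝ) :
    ‖Complex.exp (Complex.I * x) - 1 - Complex.I * x‖ ≤ 3 * x ^ 2 := by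
  have hn : ‖Complex.I * (x : ℂ)‖ = |x| := by simp
  rcases le_or_gt |x| 1 with h | h
  · have := Complex.norm_exp_sub_one_sub_id_le (x := Complex.I * x) (by rwa [hn])
    rw [hn, sq_abs] at this
    nlinarith [sq_nonneg x]
  · have h1 : ‖Complex.exp (Complex.I * x)‖ = 1 := by
      rw [mul_comm, Complex.norm_exp_ofReal_mul_I]
    calc ‖Complex.exp (Complex.I * x) - 1 - Complex.I * x‖
        ≤ ‖Complex.exp (Complex.I * x)‖ + ‖(1 : ℂ)‖ + ‖Complex.I * (x : ℂ)‖ :=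
          (norm_sub_le _ _).trans (add_le_add_left (norm_sub_le _ _) _)
      _ = 1 + 1 + |x| := by rw [h1, hn, norm_one]
      _ ≤ 3 * x ^ 2 := by nlinarith [sq_abs x]

theorem norm_levyIntegrand_le (ξ y : E) :
    ‖levyIntegrand ξ y‖ ≤ (2 + 3 * ‖ξ‖ ^ 2) * min 1 (‖y‖ ^ 2) := by
  rcases lt_or_ge ‖y‖ 1 with h | h
  · have h1 : ‖y‖ ^ 2 ≤ 1 := pow_le_one₀ (norm_nonneg _) h.le
    have h2 : (inner ℝ y ξ) ^ 2 ≤ (‖y‖ * ‖ξ‖) ^ 2 := sq_le_sq' (by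
      have := abs_real_inner_le_norm y ξ
      linarith [neg_abs_le (inner ℝ y ξ)]) (real_inner_le_norm y ξ)
    rw [levyIntegrand, indicator_of_mem (by exact h), min_eq_right h1]
    refine (norm_exp_sub_one_sub_le _).trans ?_
    nlinarith [sq_nonneg ‖y‖]
  · have h1 : 1 ≤ ‖y‖ ^ 2 := one_le_pow₀ h
    rw [levyIntegrand, indicator_of_notMem (by simpa using h), min_eq_left h1]
    have h2 : ‖Complex.exp (Complex.I * (inner ℝ y ξ : ℝ))‖ = 1 := by
      rw [mul_comm, Complex.norm_exp_ofReal_mul_I]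
    have := norm_sub_le (Complex.exp (Complex.I * (inner ℝ y ξ : ℝ))) 1
    rw [h2, norm_one] at this
    simp only [Complex.ofReal_zero, mul_zero, sub_zero]
    nlinarith [sq_nonneg ‖ξ‖]

theorem measurable_levyIntegrand (ξ : E) : Measurable (levyIntegrand ξ) := by
  have : Measurable (({y | ‖y‖ < 1} : Set E).indicator fun y => inner ℝ y ξ) :=
    Measurable.indicator (by fun_prop) (measurableSet_lt measurable_norm measurable_const)
  unfold levyIntegrand
  fun_prop

theorem levyIntegrand_add_neg (ξ y : E) :
    levyIntegrand ξ y + levyIntegrand ξ (-y) = 2 * ((Real.cos (inner ℝ y ξ) - 1 : ℝ) : ℂ) := by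
  have e : ({y | ‖y‖ < 1} : Set E).indicator (fun y => inner ℝ y ξ) (-y) =
      -({y | ‖y‖ < 1} : Set E).indicator (fun y => inner ℝ y ξ) y := by
    by_cases h : ‖y‖ < 1
    · rw [indicator_of_mem (by simpa using h), indicator_of_mem (by exact h), inner_neg_left]
    · rw [indicator_of_notMem (by simpa using h), indicator_of_notMem (by exact h), neg_zero]
  rw [levyIntegrand, levyIntegrand, e, inner_neg_left, Complex.ofReal_sub, Complex.ofReal_cos,
    Complex.cos]
  push_cast
  ring_nf

/-- The Lévy–Khintchine integral of the mixed density, computed from its even part `cos (y · ξ) - 1`. -/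
theorem integral_levyIntegrand (hd : 1 ≤ d) (ξ : E) :
    ∫ y, levyIntegrand ξ y ∂((volume : Measure E).withDensity mixedDensity) = -Phi ξ := by
  set Lm := (volume : Measure E).withDensity mixedDensity with hLm
  have hint : Integrable (levyIntegrand ξ) Lm := by
    have h1 : Integrable (fun y : E => min 1 (‖y‖ ^ 2)) Lm := by
      refine ⟨by fun_prop, ?_⟩
      rw [hasFiniteIntegral_iff_ofReal (ae_of_all _ fun y => by positivity)]
      exact (isLevyMeasure_mixedDensity hd).2
    exact (h1.const_mul _).mono' (measurable_levyIntegrand ξ).aestronglyMeasurable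
      (ae_of_all _ (norm_levyIntegrand_le ξ))
  -- The Lévy measure is symmetric, which removes the odd part of the integrand.
  have hmap : Lm.map Neg.neg = Lm := by
    ext s hs
    rw [Measure.map_apply measurable_neg hs, hLm, withDensity_apply _ hs,
      withDensity_apply _ (measurable_neg hs), ← lintegral_indicator hs,
      ← lintegral_indicator (measurable_neg hs), ← lintegral_neg_eq_self]
    refine lintegral_congr fun y => ?_
    by_cases h : y ∈ s
    · rw [indicator_of_mem h, indicator_of_mem (by simpa using h), mixedDensity, norm_neg,
        mixedDensity]
    · rw [indicator_of_notMem h, indicator_of_notMem (by simpa using h)]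
  have hneg : ∫ y, levyIntegrand ξ (-y) ∂Lm = ∫ y, levyIntegrand ξ y ∂Lm := by
    conv_rhs => rw [← hmap]
    rw [integral_map measurable_neg.aemeasurable
      (measurable_levyIntegrand ξ).aestronglyMeasurable]
  have hintneg : Integrable (fun y => levyIntegrand ξ (-y)) Lm := by
    rw [← hmap] at hint
    exact hint.comp_measurable measurable_neg
  have hcos : ∫ y : E, (1 - Real.cos (inner ℝ y ξ)) ∂Lm = phi (‖ξ‖ ^ 2) := by
    rw [integral_eq_lintegral_of_nonneg_ae
      (ae_of_all _ fun y => by simpa using Real.cos_le_one (inner ℝ y ξ)) (by fun_prop), hLm,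
      lintegral_withDensity_eq_lintegral_mul _ measurable_mixedDensity (by fun_prop)]
    simp only [Pi.mul_apply]
    rw [lintegral_mixedDensity_mul_one_sub_cos, ENNReal.toReal_ofReal (phi_nonneg (sq_nonneg _))]
  have hsum := integral_add hint hintneg
  simp_rw [levyIntegrand_add_neg] at hsum
  rw [hneg, integral_const_mul, integral_complex_ofReal] at hsum
  have h2 : ∫ y : E, (Real.cos (inner ℝ y ξ) - 1) ∂Lm = -phi (‖ξ‖ ^ 2) := by
    rw [← hcos, ← integral_neg]
    simp
  rw [h2] at hsum
  rw [Phi]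
  push_cast at hsum ⊢
  linear_combination -hsum / 2

theorem levyKhintchine_radialLevyDensity (hd : 1 ≤ d) :
    levyKhintchine 0 0 ((volume : Measure E).withDensity
      (fun y => ENNReal.ofReal (radialLevyDensity d subordinatorMeasure ‖y‖))) = Phi := by
  ext ξ
  have h := integral_levyIntegrand hd ξ
  simp only [levyIntegrand] at h
  rw [withDensity_radialLevyDensity hd, levyKhintchine, h]
  simp

end Gaussian

/-! ### Asymptotics of the Lévy density at the origin -/

/-- The Gamma integral after inversion of the variable. -/
theorem integral_rpow_mul_exp_neg_inv {p : ℝ} (hp : 0 < p) :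
    ∫ t in Ioi (0 : ℝ), t ^ (-p - 1) * Real.exp (-1 / (4 * t)) = 4 ^ p * Real.Gamma p := by
  have h := integral_comp_rpow_Ioi (fun y : ℝ => y ^ (p - 1) * Real.exp (-(1 / 4 * y)))
    (p := -1) (by norm_num)
  rw [Real.integral_rpow_mul_exp_neg_mul_Ioi hp (by norm_num)] at h
  rw [show (1 : ℝ) / (1 / 4) = 4 by norm_num] at h
  rw [← h]
  refine setIntegral_congr_fun measurableSet_Ioi fun t ht => ?_
  have ht : 0 < t := ht
  simp only [smul_eq_mul, abs_neg, abs_one, one_mul]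
  rw [← Real.rpow_mul ht.le, ← mul_assoc, ← Real.rpow_add ht, Real.rpow_neg_one]
  congr 2
  · ring
  · field_simp

theorem integrableOn_rpow_mul_exp_neg_inv {p : ℝ} (hp : 0 < p) :
    IntegrableOn (fun t : ℝ => t ^ (-p - 1) * Real.exp (-1 / (4 * t))) (Ioi 0) := by
  by_contra h
  have h1 := integral_rpow_mul_exp_neg_inv hp
  rw [integral_undef h] at h1
  exact (mul_pos (Real.rpow_pos_of_pos four_pos p) (Real.Gamma_pos_of_pos hp)).ne h1

/-- The integral `∫₀¹ u w(u) τ^u e^{-L u} du`, `w` being `stableWeight`, rescaled by `L²` and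
written in the variable `L u`. -/
noncomputable def laplaceAverage (L τ : ℝ) : ℝ :=
  ∫ w in Ioi 0, (Iio 1).indicator (fun u => stableWeight u * τ ^ u) (w / L) * (w * Real.exp (-w))

theorem integral_mul_exp_neg_Ioi : ∫ w in Ioi (0 : ℝ), w * Real.exp (-w) = 1 := by
  have h := Real.integral_rpow_mul_exp_neg_mul_Ioi two_pos one_pos
  norm_num at h
  exact h

theorem integrableOn_mul_exp_neg_Ioi : IntegrableOn (fun w : ℝ => w * Real.exp (-w)) (Ioi 0) := by
  by_contra h
  have h1 := integral_mul_exp_neg_Ioi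
  rw [integral_undef h] at h1
  exact zero_ne_one h1

theorem rpow_le_one_add {τ u : ℝ} (hτ : 0 < τ) (h0 : 0 ≤ u) (h1 : u ≤ 1) : τ ^ u ≤ 1 + τ := by
  rcases le_total τ 1 with h | h
  · linarith [Real.rpow_le_one hτ.le h h0]
  · have := Real.rpow_le_rpow_of_exponent_le h h1
    rw [Real.rpow_one] at this
    linarith

theorem abs_indicator_stableWeight_le {C : ℝ} (hC0 : 0 < C)
    (hC : ∀ u ∈ Icc (0 : ℝ) 1, |stableWeight u| ≤ C) {L τ w : ℝ} (hL : 0 < L) (hτ : 0 < τ)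
    (hw : 0 < w) :
    ‖(Iio 1).indicator (fun u => stableWeight u * τ ^ u) (w / L) * (w * Real.exp (-w))‖ ≤
      C * (1 + τ) * (w * Real.exp (-w)) := by
  have h1 : 0 ≤ w * Real.exp (-w) := by positivity
  rw [norm_mul, Real.norm_of_nonneg h1]
  refine mul_le_mul_of_nonneg_right ?_ h1
  have hu : 0 ≤ w / L := by positivity
  by_cases h : w / L < 1
  · rw [indicator_of_mem (by exact h), norm_mul, Real.norm_eq_abs,
      Real.norm_of_nonneg (Real.rpow_nonneg hτ.le _)]
    exact mul_le_mul (hC _ ⟨hu, h.le⟩) (rpow_le_one_add hτ hu h.le) (Real.rpow_nonneg hτ.le _) hC0.le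
  · rw [indicator_of_notMem (by exact h), norm_zero]
    positivity

theorem measurable_laplaceAverage_integrand :
    Measurable fun p : (ℝ × ℝ) × ℝ => (Iio 1).indicator
      (fun u => stableWeight u * p.1.2 ^ u) (p.2 / p.1.1) * (p.2 * Real.exp (-p.2)) := by
  have hs : MeasurableSet {p : (ℝ × ℝ) × ℝ | p.2 / p.1.1 < 1} :=
    measurableSet_lt (by fun_prop) measurable_const
  have hw := continuous_stableWeight.measurable
  have : Measurable ({p : (ℝ × ℝ) × ℝ | p.2 / p.1.1 < 1}.indicator
      fun p => stableWeight (p.2 / p.1.1) * p.1.2 ^ (p.2 / p.1.1)) :=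
    Measurable.indicator (by fun_prop) hs
  refine Measurable.mul ?_ (by fun_prop)
  exact this

theorem exists_abs_laplaceAverage_le :
    ∃ C : ℝ, 0 < C ∧ ∀ L τ : ℝ, 0 < L → 0 < τ → |laplaceAverage L τ| ≤ C * (1 + τ) := by
  obtain ⟨C, hC0, hC⟩ := exists_stableWeight_le
  refine ⟨C, hC0, fun L τ hL hτ => ?_⟩
  have h := norm_integral_le_of_norm_le (μ := volume.restrict (Ioi (0 : ℝ)))
    (integrableOn_mul_exp_neg_Ioi.const_mul (C * (1 + τ)))
    (by
      filter_upwards [ae_restrict_mem measurableSet_Ioi] with w hw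
      exact abs_indicator_stableWeight_le hC0 hC hL hτ hw)
  rw [integral_const_mul, integral_mul_exp_neg_Ioi, mul_one] at h
  exact h

theorem tendsto_laplaceAverage {τ : ℝ} (hτ : 0 < τ) :
    Tendsto (fun L => laplaceAverage L τ) atTop (𝓝 1) := by
  obtain ⟨C, hC0, hC⟩ := exists_stableWeight_le
  rw [← integral_mul_exp_neg_Ioi]
  refine tendsto_integral_filter_of_dominated_convergence
    (fun w => C * (1 + τ) * (w * Real.exp (-w))) (Eventually.of_forall fun L => ?_) ?_
    (integrableOn_mul_exp_neg_Ioi.const_mul _) ?_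
  · exact (measurable_laplaceAverage_integrand.comp
      (measurable_const.prodMk measurable_id : Measurable fun w : ℝ => ((L, τ), w))).aestronglyMeasurable
  · filter_upwards [eventually_gt_atTop 0] with L hL
    filter_upwards [ae_restrict_mem measurableSet_Ioi] with w hw
    exact abs_indicator_stableWeight_le hC0 hC hL hτ hw
  · filter_upwards [ae_restrict_mem measurableSet_Ioi] with w hw
    have hu : Tendsto (fun L => w / L) atTop (𝓝 0) := tendsto_const_nhds.div_atTop tendsto_id
    have hcont : Continuous fun u => stableWeight u * τ ^ u :=
      continuous_stableWeight.mul (Real.continuous_const_rpow hτ.ne')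
    have h1 : Tendsto (fun L => stableWeight (w / L) * τ ^ (w / L)) atTop (𝓝 1) := by
      have := (hcont.tendsto 0).comp hu
      simpa [stableWeight, Function.comp_def] using this
    have h2 : Tendsto (fun L => (Iio 1).indicator (fun u => stableWeight u * τ ^ u) (w / L)) atTop
        (𝓝 1) := by
      refine h1.congr' ?_
      filter_upwards [hu.eventually_lt_const one_pos] with L hL
      rw [indicator_of_mem (by exact hL)]
    simpa using h2.mul_const (w * Real.exp (-w))

theorem subordinatorDensity_exp_neg_mul {L τ : ℝ} (hL : 0 < L) (hτ : 0 < τ) :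
    subordinatorDensity (Real.exp (-L) * τ) = Real.exp (-(Real.exp (-L) * τ)) *
      (Real.exp (-L) * τ) ^ (-2 : ℝ) * (laplaceAverage L τ / L ^ 2) := by
  have hq : 0 < Real.exp (-L) * τ := by positivity
  have h1 : laplaceAverage L τ =
      L * ∫ u in Ioo (0 : ℝ) 1, stableWeight u * τ ^ u * (L * u * Real.exp (-(L * u))) := by
    have h := integral_comp_mul_left_Ioi (fun u => (Iio 1).indicator
      (fun u => stableWeight u * τ ^ u) u * (L * u * Real.exp (-(L * u)))) 0 (inv_pos.2 hL)
    rw [mul_zero, inv_inv, smul_eq_mul] at h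
    have e : ∀ w, L * (L⁻¹ * w) = w := fun w => mul_inv_cancel_left₀ hL.ne' w
    simp_rw [e, ← div_eq_inv_mul] at h
    rw [laplaceAverage, h, ← Ioi_inter_Iio, ← setIntegral_indicator measurableSet_Iio]
    congr 2
    ext u
    by_cases hu : u ∈ Iio (1 : ℝ)
    · rw [indicator_of_mem hu, indicator_of_mem hu]
    · rw [indicator_of_notMem hu, indicator_of_notMem hu, zero_mul]
  rw [h1, subordinatorDensity, mul_div_assoc', div_eq_mul_inv, ← integral_const_mul,
    ← integral_const_mul, ← integral_mul_const]
  refine setIntegral_congr_fun measurableSet_Ioo fun u hu => ?_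
  have e1 : (Real.exp (-L) * τ) ^ (u - 2) =
      (Real.exp (-L) * τ) ^ (-2 : ℝ) * (Real.exp (-(L * u)) * τ ^ u) := by
    rw [sub_eq_add_neg, add_comm, Real.rpow_add hq,
      Real.mul_rpow (z := u) (Real.exp_pos _).le hτ.le, ← Real.exp_mul (-L) u, neg_mul]
  simp only [relativisticDensity, e1]
  field_simp

/-- `radialLevyDensity` at distance `e^{-L / 2}`, rescaled to converge as `L → ∞`. -/
noncomputable def rescaledDensity (d : ℕ) (L : ℝ) : ℝ :=
  ∫ τ in Ioi 0, τ ^ (-((d : ℝ) / 2 + 1) - 1) * Real.exp (-1 / (4 * τ)) *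
    (Real.exp (-(Real.exp (-L) * τ)) * laplaceAverage L τ)

theorem tendsto_rescaledDensity {d : ℕ} (hd : 1 ≤ d) :
    Tendsto (rescaledDensity d) atTop
      (𝓝 (4 ^ ((d : ℝ) / 2 + 1) * Real.Gamma ((d : ℝ) / 2 + 1))) := by
  obtain ⟨C, hC0, hC⟩ := exists_abs_laplaceAverage_le
  have hd0 : 0 < (d : ℝ) / 2 := by positivity
  rw [← integral_rpow_mul_exp_neg_inv (by positivity)]
  refine tendsto_integral_filter_of_dominated_convergence
    (fun τ => C * (τ ^ (-((d : ℝ) / 2 + 1) - 1) * Real.exp (-1 / (4 * τ)) +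
      τ ^ (-((d : ℝ) / 2) - 1) * Real.exp (-1 / (4 * τ)))) (Eventually.of_forall fun L => ?_) ?_
    (((integrableOn_rpow_mul_exp_neg_inv (by positivity)).add
      (integrableOn_rpow_mul_exp_neg_inv hd0)).const_mul C) ?_
  · have h : Measurable fun τ => laplaceAverage L τ :=
      ((measurable_laplaceAverage_integrand.comp
        ((measurable_const.prodMk measurable_fst).prodMk measurable_snd :
          Measurable fun p : ℝ × ℝ => ((L, p.1), p.2))).stronglyMeasurable.integral_prod_right'
        (ν := volume.restrict (Ioi 0))).measurable
    exact Measurable.aestronglyMeasurable (by fun_prop)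
  · filter_upwards [eventually_gt_atTop 0] with L hL
    filter_upwards [ae_restrict_mem measurableSet_Ioi] with τ hτ
    have hτ : 0 < τ := hτ
    have h1 : Real.exp (-(Real.exp (-L) * τ)) ≤ 1 :=
      Real.exp_le_one_iff.2 (neg_nonpos.2 (by positivity))
    have e : τ ^ (-((d : ℝ) / 2) - 1) = τ ^ (-((d : ℝ) / 2 + 1) - 1) * τ := by
      rw [← Real.rpow_add_one hτ.ne']
      congr 1
      ring
    rw [norm_mul, norm_mul (Real.exp _), Real.norm_of_nonneg (by positivity),
      Real.norm_of_nonneg (Real.exp_pos _).le, Real.norm_eq_abs, e]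
    calc τ ^ (-((d : ℝ) / 2 + 1) - 1) * Real.exp (-1 / (4 * τ)) *
          (Real.exp (-(Real.exp (-L) * τ)) * |laplaceAverage L τ|)
        ≤ τ ^ (-((d : ℝ) / 2 + 1) - 1) * Real.exp (-1 / (4 * τ)) * (1 * (C * (1 + τ))) := by
          gcongr
          exact hC L τ hL hτ
      _ = _ := by ring
  · filter_upwards [ae_restrict_mem measurableSet_Ioi] with τ hτ
    have h1 : Tendsto (fun L : ℝ => Real.exp (-(Real.exp (-L) * τ))) atTop (𝓝 1) := by
      have h := (Real.tendsto_exp_neg_atTop_nhds_zero.mul_const τ).neg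
      simpa [Function.comp_def] using (Real.continuous_exp.tendsto _).comp h
    simpa using (h1.mul (tendsto_laplaceAverage hτ)).const_mul
      (τ ^ (-((d : ℝ) / 2 + 1) - 1) * Real.exp (-1 / (4 * τ)))

/-- The exact form of the asymptotics, obtained from the substitution `t = r² τ`. -/
theorem radialLevyDensity_eq_rescaledDensity (d : ℕ) {r : ℝ} (hr0 : 0 < r) (hr1 : r < 1) :
    radialLevyDensity d subordinatorMeasure r =
      (4 * Real.pi) ^ (-(d : ℝ) / 2) * rescaledDensity d (Real.log (1 / r ^ 2)) *
        (1 / (r ^ (d + 2) * (Real.log (1 / r ^ 2)) ^ 2)) := by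
  set L := Real.log (1 / r ^ 2) with hLdef
  have hL : 0 < L := Real.log_pos (by
    rw [lt_div_iff₀ (by positivity), one_mul]
    exact pow_lt_one₀ hr0.le hr1 two_ne_zero)
  have hq : Real.exp (-L) = r ^ 2 := by
    rw [hLdef, one_div, Real.log_inv, neg_neg, Real.exp_log (by positivity)]
  have h1 : radialLevyDensity d subordinatorMeasure r =
      ∫ t in Ioi 0, subordinatorDensity t * heatKernel d t r := by
    rw [radialLevyDensity_eq, subordinatorMeasure, integral_withDensity_eq_integral_toReal_smul
      measurable_subordinatorDensity.ennreal_ofReal (ae_of_all _ fun t => ENNReal.ofReal_lt_top)]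
    refine setIntegral_congr_fun measurableSet_Ioi fun t ht => ?_
    simp only [ENNReal.toReal_ofReal (subordinatorDensity_nonneg (le_of_lt ht)), smul_eq_mul]
  have h2 := integral_comp_mul_left_Ioi' (fun t => subordinatorDensity t * heatKernel d t r) 0
    (show 0 < r ^ 2 by positivity)
  rw [mul_zero, ← h1] at h2
  rw [← h2, smul_eq_mul, rescaledDensity, ← integral_const_mul, ← integral_const_mul,
    ← integral_mul_const]
  refine setIntegral_congr_fun measurableSet_Ioi fun τ hτ => ?_
  have hτ : 0 < τ := hτ
  have h3 := subordinatorDensity_exp_neg_mul hL hτ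
  rw [hq] at h3
  have e1 : -r ^ 2 / (4 * (r ^ 2 * τ)) = -1 / (4 * τ) := by
    field_simp
  have e2 : (r ^ 2 * τ) ^ (-2 : ℝ) = (r ^ 4)⁻¹ * τ ^ (-2 : ℝ) := by
    rw [Real.mul_rpow (by positivity) hτ.le, Real.rpow_neg (by positivity),
      Real.rpow_two, ← pow_mul]
  have e3 : (r ^ 2 * τ) ^ (-(d : ℝ) / 2) = (r ^ d)⁻¹ * τ ^ (-(d : ℝ) / 2) := by
    rw [Real.mul_rpow (by positivity) hτ.le, neg_div, Real.rpow_neg (by positivity),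
      ← Real.rpow_natCast r 2, ← Real.rpow_mul hr0.le]
    congr 2
    rw [← Real.rpow_natCast r d]
    congr 1
    push_cast
    ring
  have e4 : τ ^ (-((d : ℝ) / 2 + 1) - 1) = τ ^ (-(d : ℝ) / 2) * τ ^ (-2 : ℝ) := by
    rw [← Real.rpow_add hτ]
    congr 1
    ring
  simp only [h3, heatKernel, e1, e2, e3, e4, hq]
  field_simp
  ring

theorem tendsto_log_one_div_sq : Tendsto (fun r : ℝ => Real.log (1 / r ^ 2)) (𝓝[>] 0) atTop := by
  have h : Tendsto (fun r : ℝ => -2 * Real.log r) (𝓝[>] 0) atTop :=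
    Real.tendsto_log_nhdsGT_zero.const_mul_atBot_of_neg (by norm_num)
  refine h.congr fun r => ?_
  rw [one_div, Real.log_inv, Real.log_pow]
  push_cast
  ring

theorem radialLevyDensity_isEquivalent {d : ℕ} (hd : 1 ≤ d) :
    (fun r : ℝ => radialLevyDensity d subordinatorMeasure r) ~[𝓝[>] 0]
      (fun r : ℝ => 4 * Real.Gamma ((d : ℝ) / 2 + 1) / Real.pi ^ ((d : ℝ) / 2) *
        (1 / (r ^ (d + 2) * (Real.log (1 / r ^ 2)) ^ 2))) := by
  have hpi := Real.pi_pos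
  have hG : 0 < Real.Gamma ((d : ℝ) / 2 + 1) := Real.Gamma_pos_of_pos (by positivity)
  have hlim : Tendsto (fun r : ℝ => (4 * Real.pi) ^ (-(d : ℝ) / 2) *
      rescaledDensity d (Real.log (1 / r ^ 2))) (𝓝[>] 0)
      (𝓝 (4 * Real.Gamma ((d : ℝ) / 2 + 1) / Real.pi ^ ((d : ℝ) / 2))) := by
    have h := ((tendsto_rescaledDensity hd).comp tendsto_log_one_div_sq).const_mul
      ((4 * Real.pi) ^ (-(d : ℝ) / 2))
    convert! h using 2
    rw [neg_div, Real.rpow_neg (by positivity), Real.mul_rpow four_pos.le hpi.le,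
      Real.rpow_add_one four_ne_zero]
    field_simp
  have h1 := (isEquivalent_const_iff_tendsto (by positivity)).2 hlim
  refine (h1.mul (IsEquivalent.refl
    (u := fun r : ℝ => 1 / (r ^ (d + 2) * (Real.log (1 / r ^ 2)) ^ 2)))).congr_left ?_
  filter_upwards [Ioo_mem_nhdsGT one_pos] with r hr
  exact (radialLevyDensity_eq_rescaledDensity d hr.1 hr.2).symm

theorem tendsto_radialLevyDensity_div_stableLevyDensity {d : ℕ} (hd : 1 ≤ d) {α : ℝ} (h0 : 0 < α)
    (h2 : α < 2) :
    Tendsto (fun r : ℝ => radialLevyDensity d subordinatorMeasure r / stableLevyDensity d α r)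
      (𝓝[>] 0) atTop := by
  have hpi := Real.pi_pos
  have hG : 0 < Real.Gamma ((d : ℝ) / 2 + 1) := Real.Gamma_pos_of_pos (by positivity)
  have hG1 : 0 < Real.Gamma ((d : ℝ) / 2 + α / 2) := Real.Gamma_pos_of_pos (by positivity)
  have hG2 : 0 < Real.Gamma (1 - α / 2) := Real.Gamma_pos_of_pos (by linarith)
  refine ((radialLevyDensity_isEquivalent hd).div
    (IsEquivalent.refl (u := stableLevyDensity d α))).symm.tendsto_atTop ?_
  set K := 4 * Real.Gamma ((d : ℝ) / 2 + 1) / Real.pi ^ ((d : ℝ) / 2) with hK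
  set K' := α * 2 ^ (α - 1) * Real.Gamma ((d : ℝ) / 2 + α / 2)
      / (Real.pi ^ ((d : ℝ) / 2) * Real.Gamma (1 - α / 2)) with hK'
  have hKpos : 0 < K := by positivity
  have hKpos' : 0 < K' := by positivity
  -- With `L = log (1 / r²)` the quotient is a constant times `exp ((1 - α / 2) L) / L²`.
  have h := ((tendsto_exp_mul_div_rpow_atTop 2 (1 - α / 2) (by linarith)).comp
    tendsto_log_one_div_sq).const_mul_atTop (div_pos hKpos hKpos')
  refine h.congr' ?_
  filter_upwards [Ioo_mem_nhdsGT one_pos] with r hr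
  have hr0 : 0 < r := hr.1
  have hL : 0 < Real.log (1 / r ^ 2) := Real.log_pos (by
    rw [lt_div_iff₀ (by positivity), one_mul]
    exact pow_lt_one₀ hr0.le hr.2 two_ne_zero)
  have e1 : Real.exp ((1 - α / 2) * Real.log (1 / r ^ 2)) = r ^ α / r ^ 2 := by
    rw [one_div, Real.log_inv, Real.log_pow, ← Real.rpow_natCast r 2, ← Real.rpow_sub hr0,
      Real.rpow_def_of_pos hr0]
    congr 1
    push_cast
    ring
  have e2 : r ^ ((d : ℝ) + α) = r ^ d * r ^ α := by
    rw [Real.rpow_add hr0, Real.rpow_natCast]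
  simp only [Function.comp_apply, Pi.div_apply, stableLevyDensity, ← hK', e1, e2, Real.rpow_two]
  have := Real.rpow_pos_of_pos hr0 α
  field_simp
  ring

end ConjGamma

theorem mainTheorem5 {d : ℕ} (hd : 1 ≤ d) {Ω : Type*} [MeasurableSpace Ω] (P : Measure Ω)
    [IsProbabilityMeasure P] (x : EuclideanSpace ℝ (Fin d))
    (X : ℝ≥0 → Ω → EuclideanSpace ℝ (Fin d))
    (hX : ConjGamma.IsLevyProcess P x X)
    (hΦ : ConjGamma.HasCharExponent P X ConjGamma.Phi) :
    (∃ μ : Measure ℝ, ConjGamma.IsSubordinatorLevyMeasure ConjGamma.phi μ) ∧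
    ∀ μ : Measure ℝ, ConjGamma.IsSubordinatorLevyMeasure ConjGamma.phi μ →
      ConjGamma.HasLevyTriplet P X 0 0
        ((volume : Measure (EuclideanSpace ℝ (Fin d))).withDensity
          (fun y => ENNReal.ofReal (ConjGamma.radialLevyDensity d μ ‖y‖))) ∧
      (fun r : ℝ => ConjGamma.radialLevyDensity d μ r) ~[𝓝[>] 0]
        (fun r : ℝ => 4 * Real.Gamma ((d : ℝ) / 2 + 1) / Real.pi ^ ((d : ℝ) / 2) *
          (1 / (r ^ (d + 2) * (Real.log (1 / r ^ 2)) ^ 2))) ∧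
      ∀ α : ℝ, 0 < α → α < 2 →
        Tendsto (fun r : ℝ => ConjGamma.radialLevyDensity d μ r / ConjGamma.stableLevyDensity d α r)
          (𝓝[>] 0) atTop := by
  refine ⟨⟨_, ConjGamma.isSubordinatorLevyMeasure_subordinatorMeasure⟩, fun μ hμ => ?_⟩
  obtain rfl := hμ.unique ConjGamma.isSubordinatorLevyMeasure_subordinatorMeasure
  refine ⟨⟨ContinuousLinearMap.isPositive_zero, ?_, ?_⟩,
    ConjGamma.radialLevyDensity_isEquivalent hd,
    fun α h0 h2 => ConjGamma.tendsto_radialLevyDensity_div_stableLevyDensity hd h0 h2⟩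
  · rw [ConjGamma.withDensity_radialLevyDensity hd]
    exact ConjGamma.isLevyMeasure_mixedDensity hd
  · rw [ConjGamma.levyKhintchine_radialLevyDensity hd]
    exact hΦ
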